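/- All Hilbert spaces are complex. Let $H_1,H_2,K_1,K_2$ be Hilbert spaces and let $\mathcal U\subset B(K_1,K_2)$, $\mathcal V\subset B(H_1,H_2)$ be weak* closed linear subspaces. Write $[\mathcal S]$ for the linear span of a set $\mathcal S$ and $[\mathcal S]^{-w^*}$ for its weak* closure. Assume that $\mathcal U$ and $\mathcal V$ are essential, where $\mathcal X\subset B(H,K)$ is called essential if $\overline{[\mathcal X H]}=K$ and $\overline{[\mathcal X^*K]}=H$. Assume also that $\mathcal U$ and $\mathcal V$ are weak TRO equivalent: there are linear subspaces $\mathcal M_i\subset B(H_i,K_i)$ with $\mathcal M_i\mathcal M_i^*\mathcal M_i\subset\mathcal M_i$ ($i=1,2$) such that $$\mathcal U=[\mathcal M_2\mathcal V\mathcal M_1^*]^{-w^*},\qquad \mathcal V=[\mathcal M_2^*\mathcal U\mathcal M_1]^{-w^*}.$$ For a linear subspace $\mathcal X\subset B(H,K)$ and $T\in B(H,K)$ put $d(T,\mathcal X)=\inf_{X\in\mathcal X}\|T-X\|$ and $$r_{\mathcal X}(T)=\sup\{|\langle T\xi,\eta\rangle| : \|\xi\|=\|\eta\|=1,\ \langle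 X\xi,\eta\rangle=0\ \text{for all } X\in\mathcal X\},$$ where the supremum of the empty set is $0$. For norm closed $\mathcal X$ let $$k(\mathcal X)=\sup_{T\notin\mathcal X}\frac{d(T,\mathcal X)}{r_{\mathcal X}(T)}\in[0,\infty]$$ be the hyperreflexivity constant, where the quotient is $\infty$ if $r_{\mathcal X}(T)=0$ (so $k(\mathcal X)=\infty$ if $\mathcal X$ is not reflexive) and the supremum of the empty set is $0$. For an index set $I$ let $M_I^w(\mathcal X)\subset B(H^I,K^I)$ be the space of all bounded operators between the Hilbert space direct sums $H^I=\ell^2(I,H)$ and $K^I=\ell^2(I,K)$ all of whose matrix entries belong to $\mathcal X$. 1. If $I$ is infinite and its cardinality is at least the cardinality of an orthonormal basis of $H_1$ and of an orthonormal basis of $H_2$, then $$k(M_I^w(\mathcal V))\le k(M_I^w(\mathcal U)).$$ 2. If $H_1,H_2,K_1,K_2$ are separable, then $k(M_\infty^w(\mathcal V))=k(M_\infty^w(\mathcal U))$, where $\infty=\aleph_0$. -/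

import Mathlib

open scoped ENNReal InnerProductSpace

namespace OperatorSpaces

noncomputable section

section Basic

variable {H K : Type*}
  [NormedAddCommGroup H] [InnerProductSpace ℂ H]
  [NormedAddCommGroup K] [InnerProductSpace ℂ K]

/-- The weak* (ultraweak) topology of `B(H, K)`: the coarsest topology for which all functionals
`T ↦ ∑ₙ ⟨T ξₙ, ηₙ⟩` with `∑ ‖ξₙ‖² < ∞` and `∑ ‖ηₙ‖² < ∞` (that is, all trace class functionals)
are continuous. -/
@[reducible] def weakStarTopology (H K : Type*)
    [NormedAddCommGroup H] [InnerProductSpace ℂ H]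
    [NormedAddCommGroup K] [InnerProductSpace ℂ K] : TopologicalSpace (H →L[ℂ] K) :=
  ⨅ (ξ : lp (fun _ : ℕ => H) 2) (η : lp (fun _ : ℕ => K) 2),
    TopologicalSpace.induced (fun T : H →L[ℂ] K => ∑' n, ⟪η n, T (ξ n)⟫_ℂ) inferInstance

/-- A subspace of `B(H, K)` that is closed in the weak* topology. -/
def IsWeakStarClosed (U : Submodule ℂ (H →L[ℂ] K)) : Prop :=
  @IsClosed _ (weakStarTopology H K) (U : Set (H →L[ℂ] K))

/-- `[S]^{-w*}`: the weak* closure of the linear span of `S`. -/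
def weakStarSpan (S : Set (H →L[ℂ] K)) : Set (H →L[ℂ] K) :=
  @closure _ (weakStarTopology H K) (Submodule.span ℂ S : Set (H →L[ℂ] K))

/-- The map `Map(S)`, with projections identified with their ranges: it sends a subspace `P` of `H`
to the closed linear span of the vectors `T y` with `T ∈ S` and `y ∈ P`. -/
def erdosMap (S : Set (H →L[ℂ] K)) (P : Submodule ℂ H) : Submodule ℂ K :=
  (Submodule.span ℂ {z : K | ∃ T ∈ S, ∃ y ∈ P, z = T y}).topologicalClosure

/-- The distance `d(T, U)` from an operator to a subspace of `B(H, K)`. -/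
def opDist (T : H →L[ℂ] K) (U : Submodule ℂ (H →L[ℂ] K)) : ℝ≥0∞ :=
  ⨅ X ∈ U, ‖T - X‖ₑ

/-- `r_U(T)`: the supremum of `|⟨T ξ, η⟩|` over all unit vectors `ξ`, `η` with `⟨X ξ, η⟩ = 0` for
every `X ∈ U`. -/
def reflexiveSeminorm (U : Submodule ℂ (H →L[ℂ] K)) (T : H →L[ℂ] K) : ℝ≥0∞ :=
  ⨆ (ξ : H) (η : K) (_ : ‖ξ‖ = 1) (_ : ‖η‖ = 1) (_ : ∀ X ∈ U, ⟪η, X ξ⟫_ℂ = 0), ‖⟪η, T ξ⟫_ℂ‖ₑ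

/-- The hyperreflexivity constant `k(U) = sup_{T ∉ U} d(T, U) / r_U(T)`, in `[0, ∞]`. For `U` norm
closed and `T ∉ U` the distance is positive, so a quotient with `r_U(T) = 0` is `∞`; thus
`k(U) = ∞` when `U` is not reflexive. -/
def hyperreflexivityConstant (U : Submodule ℂ (H →L[ℂ] K)) : ℝ≥0∞ :=
  ⨆ (T : H →L[ℂ] K) (_ : T ∉ U), opDist T U / reflexiveSeminorm U T

/-- The matrix entry `(i, j)` of an operator between the Hilbert space direct sums `H^I`, `K^I`. -/
def matrixEntry {ι : Type*} (T : lp (fun _ : ι => H) 2 →L[ℂ] lp (fun _ : ι => K) 2) (i j : ι) :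
    H →L[ℂ] K :=
  open Classical in
  (lp.evalCLM ℂ (fun _ : ι => K) 2 i).comp
    (T.comp (lp.singleContinuousLinearMap ℂ (fun _ : ι => H) 2 j))

/-- `M_I^w(U)`: the bounded operators from `H^I` to `K^I` all of whose matrix entries are in `U`. -/
def matrixSpace (ι : Type*) (U : Submodule ℂ (H →L[ℂ] K)) :
    Submodule ℂ (lp (fun _ : ι => H) 2 →L[ℂ] lp (fun _ : ι => K) 2) where
  carrier := {T | ∀ i j, matrixEntry T i j ∈ U}
  add_mem' := by
    intro S T hS hT i j
    have h : matrixEntry (S + T) i j = matrixEntry S i j + matrixEntry T i j := by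
      ext x; simp [matrixEntry]
    rw [h]
    exact U.add_mem (hS i j) (hT i j)
  zero_mem' := by
    intro i j
    have h : matrixEntry (0 : lp (fun _ : ι => H) 2 →L[ℂ] lp (fun _ : ι => K) 2) i j = 0 := by
      ext x; simp [matrixEntry]
    rw [h]
    exact U.zero_mem
  smul_mem' := by
    intro c T hT i j
    have h : matrixEntry (c • T) i j = c • matrixEntry T i j := by
      ext x; simp [matrixEntry]
    rw [h]
    exact U.smul_mem c (hT i j)

end Basic

section Adjoints

variable {H K : Type*}
  [NormedAddCommGroup H] [InnerProductSpace ℂ H] [CompleteSpace H]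
  [NormedAddCommGroup K] [InnerProductSpace ℂ K] [CompleteSpace K]

/-- `U` is essential: `Map(U)` and `Map(U*)` send the identity projection to the identity. -/
def IsEssential (U : Submodule ℂ (H →L[ℂ] K)) : Prop :=
  erdosMap (U : Set (H →L[ℂ] K)) ⊤ = ⊤ ∧
    erdosMap {S : K →L[ℂ] H | ∃ T ∈ U, S = ContinuousLinearMap.adjoint T} ⊤ = ⊤

/-- Ternary rings of operators: subspaces `M` of `B(H, K)` with `M M* M ⊆ M`. -/
def IsTRO (M : Submodule ℂ (H →L[ℂ] K)) : Prop :=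
  ∀ A ∈ M, ∀ B ∈ M, ∀ C ∈ M, A ∘L ContinuousLinearMap.adjoint B ∘L C ∈ M

end Adjoints

section Equivalence

variable {H₁ H₂ K₁ K₂ : Type*}
  [NormedAddCommGroup H₁] [InnerProductSpace ℂ H₁] [CompleteSpace H₁]
  [NormedAddCommGroup H₂] [InnerProductSpace ℂ H₂] [CompleteSpace H₂]
  [NormedAddCommGroup K₁] [InnerProductSpace ℂ K₁] [CompleteSpace K₁]
  [NormedAddCommGroup K₂] [InnerProductSpace ℂ K₂] [CompleteSpace K₂]

/-- `U ⊆ B(K₁, K₂)` and `V ⊆ B(H₁, H₂)` are weak TRO equivalent: there are TROs `Mᵢ ⊆ B(Hᵢ, Kᵢ)`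
with `U = [M₂ V M₁*]^{-w*}` and `V = [M₂* U M₁]^{-w*}`. -/
def WeakTROEquivalent (U : Submodule ℂ (K₁ →L[ℂ] K₂)) (V : Submodule ℂ (H₁ →L[ℂ] H₂)) : Prop :=
  ∃ (M₁ : Submodule ℂ (H₁ →L[ℂ] K₁)) (M₂ : Submodule ℂ (H₂ →L[ℂ] K₂)),
    IsTRO M₁ ∧ IsTRO M₂ ∧
    (U : Set (K₁ →L[ℂ] K₂)) =
      weakStarSpan {X | ∃ B ∈ M₂, ∃ T ∈ V, ∃ A ∈ M₁,
        X = B ∘L T ∘L ContinuousLinearMap.adjoint A} ∧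
    (V : Set (H₁ →L[ℂ] H₂)) =
      weakStarSpan {X | ∃ B ∈ M₂, ∃ T ∈ U, ∃ A ∈ M₁,
        X = ContinuousLinearMap.adjoint B ∘L T ∘L A}

end Equivalence

end

end OperatorSpaces

/-! Let `M₁`, `M₂` be the norm closures of the ternary rings that implement the equivalence.
Continuous functional calculus applied to finite sums `∑ n* n` with `n ∈ Mᵢ` produces contractive
finite columns with entries in `Mᵢ` whose Gram operators `∑ m* m` tend to `1` strongly, because `V`
is essential. An infinite index set `I` absorbs a finite column (`I × J ≃ I`), so these columns
amplify to contractions `A : H₁^I → K₁^I` and `B : H₂^I → K₂^I` such that `T ↦ B T A*` maps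
`M_I^w(V)` into `M_I^w(U)` and `S ↦ B* S A` maps `M_I^w(U)` back into `M_I^w(V)`.

The first map does not increase the seminorms `r`, the second does not increase the distances `d`,
whence `d(B* B T A* A, M_I^w(V)) ≤ k(M_I^w(U)) r(T)`. Since `B* B T A* A → T` boundedly and weakly,
and the distance to a weak* closed subspace is lower semicontinuous along such limits (bounded weak*
closed sets are compact in the weak operator topology), the same bound holds for `d(T, M_I^w(V))`.
-/

namespace OperatorSpaces

open Filter Topology
open scoped Pointwise
open ContinuousLinearMap (adjoint)
open ContinuousLinearMapWOT (ofCLM toCLM)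

section WeakStarTopology

variable {H K H' K' : Type*}
  [NormedAddCommGroup H] [InnerProductSpace ℂ H]
  [NormedAddCommGroup K] [InnerProductSpace ℂ K]
  [NormedAddCommGroup H'] [InnerProductSpace ℂ H']
  [NormedAddCommGroup K'] [InnerProductSpace ℂ K']

theorem continuous_weakStar_tsum_inner (ξ : lp (fun _ : ℕ => H) 2) (η : lp (fun _ : ℕ => K) 2) :
    @Continuous _ _ (weakStarTopology H K) _ fun T : H →L[ℂ] K => ∑' n, ⟪η n, T (ξ n)⟫_ℂ :=
  continuous_iff_le_induced.2 (iInf_le_of_le ξ (iInf_le _ η))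

theorem continuous_weakStar_iff {X : Type*} [TopologicalSpace X] {f : X → H →L[ℂ] K} :
    @Continuous _ _ _ (weakStarTopology H K) f ↔
      ∀ (ξ : lp (fun _ : ℕ => H) 2) (η : lp (fun _ : ℕ => K) 2),
        Continuous fun x => ∑' n, ⟪η n, f x (ξ n)⟫_ℂ := by
  simp only [continuous_iInf_rng, continuous_induced_rng, Function.comp_def]

theorem continuous_weakStar_inner (x : H) (y : K) :
    @Continuous _ _ (weakStarTopology H K) _ fun T : H →L[ℂ] K => ⟪y, T x⟫_ℂ := by
  convert continuous_weakStar_tsum_inner (lp.single 2 0 x) (lp.single 2 0 y) with T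
  rw [tsum_eq_single 0 fun n hn => by simp [Pi.single_eq_of_ne hn]]
  simp

theorem tendsto_weakStar_of_tendsto_inner {α : Type*} {l : Filter α} {X : α → H →L[ℂ] K}
    {T : H →L[ℂ] K} {C : ℝ} (hX : ∀ᶠ a in l, ‖X a‖ ≤ C)
    (hT : ∀ x y, Tendsto (fun a => ⟪y, X a x⟫_ℂ) l (𝓝 ⟪y, T x⟫_ℂ)) :
    Tendsto X l (@nhds _ (weakStarTopology H K) T) := by
  simp only [nhds_iInf, tendsto_iInf, nhds_induced, tendsto_comap_iff]
  intro ξ η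
  have hsum : Summable fun n => ‖η n‖ * ‖ξ n‖ := by
    simpa using lp.summable_mul (by simpa using Real.HolderConjugate.two_two)
      (⟨_, (lp.memℓp η).norm⟩ : lp (fun _ : ℕ => ℝ) 2) (⟨_, (lp.memℓp ξ).norm⟩ : lp _ 2)
  refine tendsto_tsum_of_dominated_convergence (f := fun a n => ⟪η n, X a (ξ n)⟫_ℂ)
    (hsum.mul_left C) (fun n => hT _ _) ?_
  filter_upwards [hX] with a ha n
  calc ‖⟪η n, X a (ξ n)⟫_ℂ‖ ≤ ‖η n‖ * ‖X a (ξ n)‖ := norm_inner_le_norm _ _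
    _ ≤ ‖η n‖ * (C * ‖ξ n‖) := by gcongr; exact (X a).le_of_opNorm_le ha _
    _ = C * (‖η n‖ * ‖ξ n‖) := by ring

theorem IsWeakStarClosed.mem_of_tendsto_inner {W : Submodule ℂ (H →L[ℂ] K)}
    (hW : IsWeakStarClosed W) {α : Type*} {l : Filter α} [NeBot l] {X : α → H →L[ℂ] K}
    {T : H →L[ℂ] K} {C : ℝ} (hXW : ∀ᶠ a in l, X a ∈ W) (hX : ∀ᶠ a in l, ‖X a‖ ≤ C)
    (hT : ∀ x y, Tendsto (fun a => ⟪y, X a x⟫_ℂ) l (𝓝 ⟪y, T x⟫_ℂ)) : T ∈ W := by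
  let _ := weakStarTopology H K
  exact IsClosed.mem_of_tendsto hW (tendsto_weakStar_of_tendsto_inner hX hT) hXW

theorem IsWeakStarClosed.isClosed {W : Submodule ℂ (H →L[ℂ] K)} (hW : IsWeakStarClosed W) :
    IsClosed (W : Set (H →L[ℂ] K)) := by
  refine isClosed_of_closure_subset fun T hT => ?_
  have : NeBot (𝓝[(W : Set (H →L[ℂ] K))] T) := mem_closure_iff_nhdsWithin_neBot.1 hT
  have hbound : ∀ᶠ X in 𝓝 T, ‖X‖ ≤ ‖T‖ + 1 :=
    (continuous_norm.tendsto T).eventually_le_const (lt_add_one _)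
  refine hW.mem_of_tendsto_inner (l := 𝓝[W] T) (X := id) self_mem_nhdsWithin
    (nhdsWithin_le_nhds hbound) fun x y => ?_
  have hcont : Continuous fun X : H →L[ℂ] K => ⟪y, X x⟫_ℂ := by fun_prop
  exact (hcont.tendsto T).mono_left nhdsWithin_le_nhds

theorem isWeakStarClosed_of_eq_weakStarSpan {W : Submodule ℂ (H →L[ℂ] K)}
    {S : Set (H →L[ℂ] K)} (h : (W : Set (H →L[ℂ] K)) = weakStarSpan S) : IsWeakStarClosed W := by
  let _ := weakStarTopology H K
  rw [IsWeakStarClosed, h]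
  exact isClosed_closure

theorem subset_weakStarSpan (S : Set (H →L[ℂ] K)) : S ⊆ weakStarSpan S :=
  Submodule.subset_span.trans (@subset_closure _ (weakStarTopology H K) _)

theorem continuous_weakStar_comp_comp [CompleteSpace K] [CompleteSpace K'] (B : K →L[ℂ] K')
    (A : H' →L[ℂ] H) :
    @Continuous _ _ (weakStarTopology H K) (weakStarTopology H' K')
      fun T : H →L[ℂ] K => B ∘L T ∘L A := by
  let _ := weakStarTopology H K
  refine continuous_weakStar_iff.2 fun ξ η => ?_
  let ξ' := lp.mapCLM 2 (fun _ : ℕ => A) (norm_nonneg A) (fun _ => le_rfl) ξ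
  let η' := lp.mapCLM 2 (fun _ : ℕ => adjoint B) (norm_nonneg _) (fun _ => le_rfl) η
  have h : ∀ T : H →L[ℂ] K,
      ∑' n, ⟪η n, (B ∘L T ∘L A) (ξ n)⟫_ℂ = ∑' n, ⟪η' n, T (ξ' n)⟫_ℂ := fun T =>
    tsum_congr fun n => (ContinuousLinearMap.adjoint_inner_left B _ _).symm
  simpa only [h] using continuous_weakStar_tsum_inner ξ' η'

theorem IsWeakStarClosed.matrixSpace [CompleteSpace K] {W : Submodule ℂ (H →L[ℂ] K)}
    (hW : IsWeakStarClosed W) (ι : Type*) : IsWeakStarClosed (matrixSpace ι W) := by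
  let _ := weakStarTopology H K
  let _ := weakStarTopology (lp (fun _ : ι => H) 2) (lp (fun _ : ι => K) 2)
  change IsClosed {T : lp (fun _ : ι => H) 2 →L[ℂ] lp (fun _ : ι => K) 2 |
    ∀ i j, matrixEntry T i j ∈ W}
  simp only [Set.ofPred_forall]
  exact isClosed_iInter fun i => isClosed_iInter fun j =>
    IsClosed.preimage (continuous_weakStar_comp_comp _ _) hW

theorem inner_eq_zero_of_mem_weakStarSpan {S : Set (H →L[ℂ] K)} {x : H} {y : K}
    (h : ∀ T ∈ S, ⟪y, T x⟫_ℂ = 0) {T : H →L[ℂ] K} (hT : T ∈ weakStarSpan S) :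
    ⟪y, T x⟫_ℂ = 0 := by
  let φ : (H →L[ℂ] K) →L[ℂ] ℂ := innerSL ℂ y ∘L ContinuousLinearMap.apply ℂ K x
  have hspan : Submodule.span ℂ S ≤ LinearMap.ker φ.toLinearMap := Submodule.span_le.2 h
  let _ := weakStarTopology H K
  exact closure_minimal hspan (isClosed_singleton.preimage (continuous_weakStar_inner x y)) hT

end WeakStarTopology

section WeakOperatorTopology

variable {H K : Type*}
  [NormedAddCommGroup H] [InnerProductSpace ℂ H]
  [NormedAddCommGroup K] [InnerProductSpace ℂ K] [CompleteSpace K]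

theorem exists_tendsto_inner_of_norm_le {α : Type*} (l : Ultrafilter α) {v : α → K} {C : ℝ}
    (hv : ∀ᶠ a in l, ‖v a‖ ≤ C) :
    ∃ z, ‖z‖ ≤ C ∧ ∀ y, Tendsto (fun a => ⟪y, v a⟫_ℂ) l (𝓝 ⟪y, z⟫_ℂ) := by
  let φ : α → WeakDual ℂ K := fun a =>
    StrongDual.toWeakDual (InnerProductSpace.toDual ℂ K (v a))
  have hφ : ∀ᶠ a in l, φ a ∈ WeakDual.toStrongDual ⁻¹' Metric.closedBall 0 C := by
    filter_upwards [hv] with a ha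
    simpa [φ] using ha
  obtain ⟨f, hf, hlim⟩ := (WeakDual.isCompact_closedBall (0 : StrongDual ℂ K) C).ultrafilter_le_nhds
    (l.map φ) (le_principal_iff.2 hφ)
  let z : K := (InnerProductSpace.toDual ℂ K).symm (WeakDual.toStrongDual f)
  have hz : ∀ y, ⟪z, y⟫_ℂ = f y := fun y => InnerProductSpace.toDual_symm_apply
  refine ⟨z, by simpa [z] using hf, fun y => ?_⟩
  have hfy : Tendsto (fun a => ⟪v a, y⟫_ℂ) l (𝓝 ⟪z, y⟫_ℂ) := by
    rw [hz]
    exact ((WeakDual.eval_continuous y).tendsto f).comp hlim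
  simpa only [Function.comp_def, inner_conj_symm] using
    (Complex.continuous_conj.tendsto _).comp hfy

theorem isCompact_wot_closedBall (C : ℝ) : IsCompact {A : H →WOT[ℂ] K | ‖toCLM A‖ ≤ C} := by
  rcases lt_or_ge C 0 with hC | hC
  · simp [(hC.trans_le (norm_nonneg _)).not_ge]
  refine isCompact_iff_ultrafilter_le_nhds.2 fun l hl => ?_
  have hbound : ∀ x, ∀ᶠ A : H →WOT[ℂ] K in l, ‖A x‖ ≤ C * ‖x‖ := fun x =>
    Eventually.mono (le_principal_iff.1 hl) fun A hA => (toCLM A).le_of_opNorm_le hA x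
  choose g hg hlim using fun x => exists_tendsto_inner_of_norm_le l (hbound x)
  let G : H →ₗ[ℂ] K :=
    { toFun := g
      map_add' := fun x₁ x₂ => ext_inner_left ℂ fun y =>
        tendsto_nhds_unique (hlim _ y) <| by
          simpa [inner_add_right] using (hlim x₁ y).add (hlim x₂ y)
      map_smul' := fun c x => ext_inner_left ℂ fun y =>
        tendsto_nhds_unique (hlim _ y) <| by
          simpa [inner_smul_right] using (hlim x y).const_mul c }
  exact ⟨ofCLM (G.mkContinuous C hg), G.mkContinuous_norm_le hC hg,
    ContinuousLinearMapWOT.le_nhds_iff_forall_inner_apply_le_nhds.2 hlim⟩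

theorem IsWeakStarClosed.isCompact_wot_inter_closedBall {W : Submodule ℂ (H →L[ℂ] K)}
    (hW : IsWeakStarClosed W) (C : ℝ) :
    IsCompact {A : H →WOT[ℂ] K | toCLM A ∈ W ∧ ‖toCLM A‖ ≤ C} := by
  refine isCompact_iff_ultrafilter_le_nhds.2 fun l hl => ?_
  obtain ⟨hlW, hlC⟩ := eventually_and.1 (le_principal_iff.1 hl)
  obtain ⟨A, hA, hlim⟩ := (isCompact_wot_closedBall C).ultrafilter_le_nhds l
    (le_principal_iff.2 hlC)
  exact ⟨A, ⟨hW.mem_of_tendsto_inner hlW hlC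
    (ContinuousLinearMapWOT.le_nhds_iff_forall_inner_apply_le_nhds.1 hlim), hA⟩, hlim⟩

theorem IsWeakStarClosed.opDist_le_of_tendsto_inner {W : Submodule ℂ (H →L[ℂ] K)}
    (hW : IsWeakStarClosed W) {α : Type*} {l : Filter α} [NeBot l] {X : α → H →L[ℂ] K}
    {T : H →L[ℂ] K} {C : ℝ} {d : ℝ≥0∞} (hX : ∀ a, ‖X a‖ ≤ C)
    (hT : ∀ x y, Tendsto (fun a => ⟪y, X a x⟫_ℂ) l (𝓝 ⟪y, T x⟫_ℂ))
    (hd : ∀ a, opDist (X a) W ≤ d) : opDist T W ≤ d := by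
  refine le_of_forall_gt_imp_ge_of_dense fun d' hd' => ?_
  rcases eq_or_ne d' ⊤ with rfl | htop
  · exact le_top
  lift d' to NNReal using htop
  -- `X a` stays in the sum of two compact sets, which contains `T` because it is closed.
  let S := {A : H →WOT[ℂ] K | toCLM A ∈ W ∧ ‖toCLM A‖ ≤ C + d'} +
    {A : H →WOT[ℂ] K | ‖toCLM A‖ ≤ d'}
  have hS : IsClosed S :=
    ((hW.isCompact_wot_inter_closedBall _).add (isCompact_wot_closedBall _)).isClosed
  have hXS : ∀ a, ofCLM (X a) ∈ S := fun a => by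
    obtain ⟨Y, hYW, hY⟩ : ∃ Y ∈ W, ‖X a - Y‖ₑ < d' := by
      simpa only [opDist, iInf_lt_iff, exists_prop] using (hd a).trans_lt hd'
    have hY : ‖X a - Y‖ ≤ d' := by exact_mod_cast hY.le
    refine ⟨ofCLM Y, ⟨hYW, ?_⟩, ofCLM (X a - Y), hY, by simp⟩
    calc ‖Y‖ = ‖X a - (X a - Y)‖ := by rw [sub_sub_cancel]
      _ ≤ ‖X a‖ + ‖X a - Y‖ := norm_sub_le _ _
      _ ≤ C + d' := add_le_add (hX a) hY
  have hTS : ofCLM T ∈ S := hS.mem_of_tendsto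
    (ContinuousLinearMapWOT.tendsto_iff_forall_inner_apply_tendsto.2 hT) (.of_forall hXS)
  obtain ⟨Z, ⟨hZW, -⟩, D, hD, hZD⟩ := hTS
  have hTZ : T - toCLM Z = toCLM D := by
    rw [← ContinuousLinearMapWOT.toCLM_ofCLM T, ← hZD]
    simp
  refine (iInf₂_le _ hZW).trans ?_
  rw [hTZ]
  exact_mod_cast hD

end WeakOperatorTopology

section TernaryRings

variable {H K : Type*}
  [NormedAddCommGroup H] [InnerProductSpace ℂ H] [CompleteSpace H]
  [NormedAddCommGroup K] [InnerProductSpace ℂ K]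

/-- The operators on `H` that, together with their adjoints, multiply `N` into itself from the
right. For a ternary ring of operators `N` they contain the operators `n* n` with `n ∈ N`. -/
def rightMultipliers (N : Submodule ℂ (H →L[ℂ] K)) : StarSubalgebra ℂ (H →L[ℂ] H) where
  carrier := {x | ∀ n ∈ N, n ∘L x ∈ N ∧ n ∘L star x ∈ N}
  mul_mem' {x y} hx hy n hn := by
    rw [star_mul]
    exact ⟨(hy _ (hx n hn).1).1, (hx _ (hy n hn).2).2⟩
  add_mem' {x y} hx hy n hn := by
    rw [star_add, ContinuousLinearMap.comp_add, ContinuousLinearMap.comp_add]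
    exact ⟨N.add_mem (hx n hn).1 (hy n hn).1, N.add_mem (hx n hn).2 (hy n hn).2⟩
  algebraMap_mem' c n hn := by
    rw [← algebraMap_star_comm, Algebra.algebraMap_eq_smul_one, Algebra.algebraMap_eq_smul_one,
      ContinuousLinearMap.comp_smul, ContinuousLinearMap.comp_smul]
    exact ⟨N.smul_mem _ hn, N.smul_mem _ hn⟩
  star_mem' {x} hx n hn := by
    rw [star_star]
    exact (hx n hn).symm

theorem isClosed_rightMultipliers {N : Submodule ℂ (H →L[ℂ] K)}
    (hN : IsClosed (N : Set (H →L[ℂ] K))) :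
    IsClosed (rightMultipliers N : Set (H →L[ℂ] H)) := by
  change IsClosed {x : H →L[ℂ] H | ∀ n ∈ N, n ∘L x ∈ N ∧ n ∘L star x ∈ N}
  simp only [Set.ofPred_forall, Set.ofPred_and]
  exact isClosed_iInter fun n => isClosed_iInter fun _ =>
    (hN.preimage (by fun_prop)).inter (hN.preimage (by fun_prop))

variable [CompleteSpace K]

theorem IsTRO.topologicalClosure {M : Submodule ℂ (H →L[ℂ] K)} (hM : IsTRO M) :
    IsTRO M.topologicalClosure := by
  have hAB : ∀ A ∈ M, ∀ C ∈ M, ∀ B ∈ M.topologicalClosure,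
      A ∘L adjoint B ∘L C ∈ M.topologicalClosure := fun A hA C hC B hB =>
    map_mem_closure (f := fun B : H →L[ℂ] K => A ∘L adjoint B ∘L C)
      (by fun_prop) hB fun B hB => hM A hA B hB C hC
  intro A hA B hB C hC
  have := Submodule.isClosed_topologicalClosure M
  rw [← SetLike.mem_coe, ← this.closure_eq]
  exact map_mem_closure₂ (f := fun A C : H →L[ℂ] K => A ∘L adjoint B ∘L C) (by fun_prop) hA hC
    fun A hA C hC => hAB A hA C hC B hB

theorem IsTRO.adjoint_comp_self_mem_rightMultipliers {M : Submodule ℂ (H →L[ℂ] K)} (hM : IsTRO M)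
    {n : H →L[ℂ] K} (hn : n ∈ M) : adjoint n ∘L n ∈ rightMultipliers M := by
  have hstar : star (adjoint n ∘L n) = adjoint n ∘L n :=
    (ContinuousLinearMap.isPositive_adjoint_comp_self n).isSelfAdjoint
  intro k hk
  rw [hstar, and_self]
  exact hM k hk n hn n hn

theorem exists_isSelfAdjoint_conj_add_sq_eq_one {A : Type*} [CStarAlgebra A] [PartialOrder A]
    [StarOrderedRing A] {a : A} (ha : 0 ≤ a) {δ : ℝ} (hδ : 0 < δ) {S : StarSubalgebra ℂ A}
    (hS : IsClosed (S : Set A)) (haS : a ∈ S) :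
    ∃ c ∈ S, IsSelfAdjoint c ∧ c * a * c + (δ • c) * (δ • c) = 1 := by
  let f : ℝ → ℝ := fun t => (√(t + δ ^ 2))⁻¹
  have hpos : ∀ t ∈ spectrum ℝ a, 0 < t + δ ^ 2 := fun t ht =>
    add_pos_of_nonneg_of_pos (spectrum_nonneg_of_nonneg ha ht) (by positivity)
  have hf : ContinuousOn f (spectrum ℝ a) :=
    ContinuousOn.inv₀ (by fun_prop) fun t ht => (Real.sqrt_pos.2 (hpos t ht)).ne'
  refine ⟨cfc f a, cfc_mem (hs := hS) f haS, cfc_predicate f a, ?_⟩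
  have hconj : cfc f a * a * cfc f a = cfc (fun t => f t * t * f t) a := by
    rw [cfc_mul (fun t => f t * t) f a, cfc_mul f (fun t => t) a, cfc_id' ℝ a]
  have hsq : (δ • cfc f a) * (δ • cfc f a) = cfc (fun t => (δ • f t) * (δ • f t)) a := by
    rw [cfc_mul (fun t => δ • f t) (fun t => δ • f t) a, cfc_smul δ f a]
  rw [hconj, hsq, ← cfc_one ℝ a,
    ← cfc_add a (fun t => f t * t * f t) (fun t => (δ • f t) * (δ • f t))]
  refine cfc_congr fun t ht => ?_
  have hs := Real.sq_sqrt (hpos t ht).le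
  have hne := (Real.sqrt_pos.2 (hpos t ht)).ne'
  simp only [f, smul_eq_mul, Pi.one_apply]
  field_simp
  linarith

theorem sum_norm_sq_add_norm_sq_eq {J : Type*} [Fintype J] {m : J → H →L[ℂ] K} {d : H →L[ℂ] H}
    (h : ∑ j, adjoint (m j) ∘L m j + adjoint d ∘L d = 1) (x : H) :
    ∑ j, ‖m j x‖ ^ 2 + ‖d x‖ ^ 2 = ‖x‖ ^ 2 := by
  simp only [ContinuousLinearMap.apply_norm_sq_eq_inner_adjoint_left, ← map_sum, ← map_add,
    ← sum_inner, ← inner_add_left, ← sum_apply, ← add_apply]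
  rw [h, one_apply_eq_self, inner_self_eq_norm_sq]

theorem norm_le_one_of_sum_norm_sq_add_norm_sq_eq {J E F G : Type*} [Fintype J]
    [NormedAddCommGroup E] [NormedSpace ℂ E] [NormedAddCommGroup F] [NormedSpace ℂ F]
    [NormedAddCommGroup G] [NormedSpace ℂ G] {m : J → E →L[ℂ] F} {d : E →L[ℂ] G}
    (h : ∀ x, ∑ j, ‖m j x‖ ^ 2 + ‖d x‖ ^ 2 = ‖x‖ ^ 2) :
    (∀ j, ‖m j‖ ≤ 1) ∧ ‖d‖ ≤ 1 := by
  refine ⟨fun j => ?_, ?_⟩ <;>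
    refine ContinuousLinearMap.opNorm_le_bound _ zero_le_one fun x =>
      le_of_sq_le_sq ?_ (by positivity)
  · have := Finset.single_le_sum (fun i _ => sq_nonneg ‖m i x‖) (Finset.mem_univ j)
    linarith [h x, sq_nonneg ‖d x‖]
  · have := Finset.sum_nonneg fun j (_ : j ∈ Finset.univ) => sq_nonneg ‖m j x‖
    linarith [h x]

theorem IsTRO.exists_column {M : Submodule ℂ (H →L[ℂ] K)} (hM : IsTRO M)
    (hMc : IsClosed (M : Set (H →L[ℂ] K))) {J : Type*} [Fintype J] {n : J → H →L[ℂ] K}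
    (hn : ∀ j, n j ∈ M) {δ : ℝ} (hδ : 0 < δ) :
    ∃ m : J → H →L[ℂ] K, (∀ j, m j ∈ M) ∧ (∀ x, ∑ j, ‖m j x‖ ^ 2 ≤ ‖x‖ ^ 2) ∧
      ∀ j, ‖(∑ i, adjoint (m i) ∘L m i) ∘L adjoint (n j) - adjoint (n j)‖ ≤ δ := by
  obtain ⟨c, hcS, hc, hsq⟩ := exists_isSelfAdjoint_conj_add_sq_eq_one
    (a := ∑ j, adjoint (n j) ∘L n j) (Finset.sum_nonneg fun j _ =>
      (ContinuousLinearMap.nonneg_iff_isPositive _).2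
        (ContinuousLinearMap.isPositive_adjoint_comp_self (n j)))
    hδ (isClosed_rightMultipliers hMc)
    (sum_mem fun j _ => hM.adjoint_comp_self_mem_rightMultipliers (hn j))
  have hca : adjoint c = c := hc
  let m : J → H →L[ℂ] K := fun j => n j ∘L c
  have hone : ∑ j, adjoint (m j) ∘L m j + (δ • c) * (δ • c) = 1 := by
    rw [← hsq]
    ext x
    simp [m, ContinuousLinearMap.adjoint_comp, hca]
  have hδc : adjoint (δ • c) = δ • c := (IsSelfAdjoint.all δ).smul hc
  have hnorm := sum_norm_sq_add_norm_sq_eq (m := m) (d := δ • c) (by rw [hδc]; exact hone)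
  obtain ⟨hm, hc1⟩ := norm_le_one_of_sum_norm_sq_add_norm_sq_eq hnorm
  refine ⟨m, fun j => (hcS _ (hn j)).1, fun x => ?_, fun j => ?_⟩
  · exact (le_add_of_nonneg_right (by positivity)).trans_eq (hnorm x)
  have hdiff : (∑ i, adjoint (m i) ∘L m i) ∘L adjoint (n j) - adjoint (n j) =
      -(δ • ((δ • c) ∘L adjoint (m j))) := by
    rw [eq_sub_of_add_eq hone]
    ext x
    simp [m, ContinuousLinearMap.adjoint_comp, hca]
  rw [hdiff, norm_neg, norm_smul, Real.norm_of_nonneg hδ.le]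
  refine mul_le_of_le_one_right hδ.le ((ContinuousLinearMap.opNorm_comp_le _ _).trans ?_)
  rw [LinearIsometryEquiv.norm_map]
  exact mul_le_one₀ hc1 (norm_nonneg _) (hm j)

end TernaryRings

section ColumnOperators

/-- The inclusion `H → H^I` of the coordinate `i`. -/
noncomputable def coordIncl (H : Type*) [NormedAddCommGroup H] [InnerProductSpace ℂ H]
    {ι : Type*} (i : ι) : H →L[ℂ] lp (fun _ : ι => H) 2 :=
  open Classical in lp.singleContinuousLinearMap ℂ (fun _ : ι => H) 2 i

/-- The projection `H^I → H` onto the coordinate `i`. -/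
noncomputable def coordProj (H : Type*) [NormedAddCommGroup H] [InnerProductSpace ℂ H]
    {ι : Type*} (i : ι) : lp (fun _ : ι => H) 2 →L[ℂ] H :=
  lp.evalCLM ℂ (fun _ : ι => H) 2 i

variable {H K ι κ J : Type*}
  [NormedAddCommGroup H] [InnerProductSpace ℂ H]
  [NormedAddCommGroup K] [InnerProductSpace ℂ K]

theorem coordIncl_apply [DecidableEq ι] (i k : ι) (x : H) :
    coordIncl H i x k = if k = i then x else 0 := by
  simp only [coordIncl, lp.singleContinuousLinearMap_apply, lp.coeFn_single, Pi.single_apply]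
  congr

theorem norm_coordIncl_apply (i : ι) (x : H) : ‖coordIncl H i x‖ = ‖x‖ := by
  classical
  exact lp.norm_single (E := fun _ : ι => H) (p := 2) (by norm_num) i x

theorem inner_coordIncl_left (i : ι) (x : H) (f : lp (fun _ : ι => H) 2) :
    ⟪coordIncl H i x, f⟫_ℂ = ⟪x, f i⟫_ℂ := by
  classical
  exact lp.inner_single_left (𝕜 := ℂ) (G := fun _ : ι => H) i x f

theorem adjoint_coordIncl [CompleteSpace H] (i : ι) : adjoint (coordIncl H i) = coordProj H i := by
  ext f
  refine ext_inner_left ℂ fun x => ?_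
  rw [ContinuousLinearMap.adjoint_inner_right, inner_coordIncl_left]
  rfl

theorem adjoint_coordProj [CompleteSpace H] (i : ι) : adjoint (coordProj H i) = coordIncl H i := by
  rw [← adjoint_coordIncl, ContinuousLinearMap.adjoint_adjoint]

theorem sum_column_norm_sq_le [Fintype J] (e : ι × J ≃ κ) {m : J → H →L[ℂ] K}
    (hm : ∀ x, ∑ j, ‖m j x‖ ^ 2 ≤ ‖x‖ ^ 2) (f : lp (fun _ : ι => H) 2) (s : Finset κ) :
    ∑ k ∈ s, ‖m (e.symm k).2 (f (e.symm k).1)‖ ^ 2 ≤ ‖f‖ ^ 2 := by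
  classical
  let t : Finset ι := s.image fun k => (e.symm k).1
  calc ∑ k ∈ s, ‖m (e.symm k).2 (f (e.symm k).1)‖ ^ 2
      = ∑ p ∈ s.map e.symm.toEmbedding, ‖m p.2 (f p.1)‖ ^ 2 := by simp
    _ ≤ ∑ p ∈ t ×ˢ Finset.univ, ‖m p.2 (f p.1)‖ ^ 2 := by
        refine Finset.sum_le_sum_of_subset_of_nonneg (fun p hp => ?_) fun _ _ _ => sq_nonneg _
        obtain ⟨k, hk, rfl⟩ := Finset.mem_map.1 hp
        exact Finset.mem_product.2 ⟨Finset.mem_image_of_mem _ hk, Finset.mem_univ _⟩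
    _ = ∑ i ∈ t, ∑ j, ‖m j (f i)‖ ^ 2 := Finset.sum_product ..
    _ ≤ ∑ i ∈ t, ‖f i‖ ^ 2 := Finset.sum_le_sum fun i _ => hm (f i)
    _ ≤ ‖f‖ ^ 2 := by simpa using lp.sum_rpow_le_norm_rpow (p := 2) (by norm_num) f t

/-- The direct sum of copies of the column `x ↦ (mⱼ x)ⱼ`, one for each coordinate of `H^I`, where
`e` arranges the resulting entries as the coordinates of the target. -/
noncomputable def columnOperator [Fintype J] (e : ι × J ≃ κ) (m : J → H →L[ℂ] K)
    (hm : ∀ x, ∑ j, ‖m j x‖ ^ 2 ≤ ‖x‖ ^ 2) :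
    lp (fun _ : ι => H) 2 →L[ℂ] lp (fun _ : κ => K) 2 :=
  LinearMap.mkContinuous
    { toFun := fun f => ⟨fun k => m (e.symm k).2 (f (e.symm k).1),
        memℓp_gen' fun s => by simpa using sum_column_norm_sq_le e hm f s⟩
      map_add' := fun f g => by ext k; exact map_add _ _ _
      map_smul' := fun c f => by ext k; exact map_smul _ _ _ }
    1 fun f => by
      rw [one_mul]
      exact lp.norm_le_of_forall_sum_le (by norm_num) (norm_nonneg f) fun s => by
        simpa using sum_column_norm_sq_le e hm f s

section

variable [Fintype J] (e : ι × J ≃ κ) {m : J → H →L[ℂ] K}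
  (hm : ∀ x, ∑ j, ‖m j x‖ ^ 2 ≤ ‖x‖ ^ 2)

theorem columnOperator_apply (f : lp (fun _ : ι => H) 2) (i : ι) (j : J) :
    columnOperator e m hm f (e (i, j)) = m j (f i) := by
  change m (e.symm (e (i, j))).2 (f (e.symm (e (i, j))).1) = _
  rw [e.symm_apply_apply]

theorem norm_columnOperator_le : ‖columnOperator e m hm‖ ≤ 1 :=
  LinearMap.mkContinuous_norm_le _ zero_le_one _

theorem coordProj_comp_columnOperator (i : ι) (j : J) :
    coordProj K (e (i, j)) ∘L columnOperator e m hm = m j ∘L coordProj H i :=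
  ContinuousLinearMap.ext fun f => columnOperator_apply e hm f i j

theorem columnOperator_comp_coordIncl (i : ι) :
    columnOperator e m hm ∘L coordIncl H i = ∑ j, coordIncl K (e (i, j)) ∘L m j := by
  classical
  ext x k
  obtain ⟨⟨i', j⟩, rfl⟩ := e.surjective k
  change columnOperator e m hm (coordIncl H i x) (e (i', j)) =
    coordProj K (e (i', j)) ((∑ j, coordIncl K (e (i, j)) ∘L m j) x)
  rw [columnOperator_apply, sum_apply, map_sum]
  change _ = ∑ j', coordIncl K (e (i, j')) (m j' x) (e (i', j))
  by_cases h : i' = i <;> simp [coordIncl_apply, h]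

variable [CompleteSpace H] [CompleteSpace K]

theorem adjoint_columnOperator_comp_coordIncl (i : ι) (j : J) :
    adjoint (columnOperator e m hm) ∘L coordIncl K (e (i, j)) =
      coordIncl H i ∘L adjoint (m j) := by
  simp only [← adjoint_coordProj, ← ContinuousLinearMap.adjoint_comp,
    coordProj_comp_columnOperator]

theorem coordProj_comp_adjoint_columnOperator (i : ι) :
    coordProj H i ∘L adjoint (columnOperator e m hm) =
      ∑ j, adjoint (m j) ∘L coordProj K (e (i, j)) := by
  simp only [← adjoint_coordIncl, ← ContinuousLinearMap.adjoint_comp,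
    columnOperator_comp_coordIncl, map_sum]

theorem adjoint_columnOperator_columnOperator_coordIncl (i : ι) (x : H) :
    adjoint (columnOperator e m hm) (columnOperator e m hm (coordIncl H i x)) =
      coordIncl H i ((∑ j, adjoint (m j) ∘L m j) x) := by
  have hcol := DFunLike.congr_fun (columnOperator_comp_coordIncl e hm i) x
  have hadj := fun j => DFunLike.congr_fun (adjoint_columnOperator_comp_coordIncl e hm i j) (m j x)
  simp only [ContinuousLinearMap.comp_apply, sum_apply] at hcol hadj ⊢
  simp only [hcol, map_sum, hadj]

end

/-- `N*`, the space of the adjoints of the operators in `N`. -/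
noncomputable def adjointSpace [CompleteSpace H] [CompleteSpace K] (N : Submodule ℂ (H →L[ℂ] K)) :
    Submodule ℂ (K →L[ℂ] H) :=
  N.comap (adjoint : (K →L[ℂ] H) ≃ₗᵢ⋆[ℂ] (H →L[ℂ] K)).toLinearEquiv.toLinearMap

theorem mem_adjointSpace [CompleteSpace H] [CompleteSpace K] {N : Submodule ℂ (H →L[ℂ] K)}
    {A : K →L[ℂ] H} : A ∈ adjointSpace N ↔ adjoint A ∈ N := Iff.rfl

/-- Every row of the operator matrix `A` has finitely many nonzero entries, all of them in `N`. -/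
def HasFiniteRowsIn (N : Submodule ℂ (H →L[ℂ] K))
    (A : lp (fun _ : ι => H) 2 →L[ℂ] lp (fun _ : κ => K) 2) : Prop :=
  ∀ k, coordProj K k ∘L A ∈ Submodule.span ℂ {R | ∃ n ∈ N, ∃ i, R = n ∘L coordProj H i}

theorem hasFiniteRowsIn_columnOperator [Fintype J] (e : ι × J ≃ κ) {m : J → H →L[ℂ] K}
    (hm : ∀ x, ∑ j, ‖m j x‖ ^ 2 ≤ ‖x‖ ^ 2) {N : Submodule ℂ (H →L[ℂ] K)} (hmN : ∀ j, m j ∈ N) :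
    HasFiniteRowsIn N (columnOperator e m hm) := by
  intro k
  obtain ⟨⟨i, j⟩, rfl⟩ := e.surjective k
  rw [coordProj_comp_columnOperator]
  exact Submodule.subset_span ⟨m j, hmN j, i, rfl⟩

variable [CompleteSpace H] [CompleteSpace K]

theorem hasFiniteRowsIn_adjoint_columnOperator [Fintype J] (e : ι × J ≃ κ) {m : J → H →L[ℂ] K}
    (hm : ∀ x, ∑ j, ‖m j x‖ ^ 2 ≤ ‖x‖ ^ 2) {N : Submodule ℂ (H →L[ℂ] K)} (hmN : ∀ j, m j ∈ N) :
    HasFiniteRowsIn (adjointSpace N) (adjoint (columnOperator e m hm)) := by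
  intro i
  rw [coordProj_comp_adjoint_columnOperator]
  refine sum_mem fun j _ => Submodule.subset_span ⟨_, ?_, e (i, j), rfl⟩
  rw [mem_adjointSpace, ContinuousLinearMap.adjoint_adjoint]
  exact hmN j

end ColumnOperators

section MatrixCompression

variable {H₁ H₂ K₁ K₂ ι : Type*}
  [NormedAddCommGroup H₁] [InnerProductSpace ℂ H₁] [CompleteSpace H₁]
  [NormedAddCommGroup H₂] [InnerProductSpace ℂ H₂]
  [NormedAddCommGroup K₁] [InnerProductSpace ℂ K₁] [CompleteSpace K₁]
  [NormedAddCommGroup K₂] [InnerProductSpace ℂ K₂]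
  {U : Submodule ℂ (K₁ →L[ℂ] K₂)} {V : Submodule ℂ (H₁ →L[ℂ] H₂)}
  {N₁ : Submodule ℂ (H₁ →L[ℂ] K₁)} {N₂ : Submodule ℂ (H₂ →L[ℂ] K₂)}

theorem HasFiniteRowsIn.comp_comp_adjoint_mem_matrixSpace
    {B : lp (fun _ : ι => H₂) 2 →L[ℂ] lp (fun _ : ι => K₂) 2} (hB : HasFiniteRowsIn N₂ B)
    {A : lp (fun _ : ι => H₁) 2 →L[ℂ] lp (fun _ : ι => K₁) 2} (hA : HasFiniteRowsIn N₁ A)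
    (hVU : ∀ b ∈ N₂, ∀ T ∈ V, ∀ a ∈ N₁, b ∘L T ∘L adjoint a ∈ U)
    {T : lp (fun _ : ι => H₁) 2 →L[ℂ] lp (fun _ : ι => H₂) 2} (hT : T ∈ matrixSpace ι V) :
    B ∘L T ∘L adjoint A ∈ matrixSpace ι U := by
  intro i j
  have hentry : matrixEntry (B ∘L T ∘L adjoint A) i j =
      (coordProj K₂ i ∘L B) ∘L T ∘L adjoint (coordProj K₁ j ∘L A) := by
    rw [ContinuousLinearMap.adjoint_comp, adjoint_coordProj]
    rfl
  have hrowB := hB i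
  have hrowA := hA j
  rw [hentry]
  generalize coordProj K₂ i ∘L B = R at hrowB ⊢
  generalize coordProj K₁ j ∘L A = C at hrowA ⊢
  induction hrowB, hrowA using Submodule.span_induction₂ with
  | mem_mem R C hR hC =>
    obtain ⟨b, hb, k, rfl⟩ := hR
    obtain ⟨a, ha, l, rfl⟩ := hC
    rw [ContinuousLinearMap.adjoint_comp, adjoint_coordProj]
    exact hVU b hb _ (hT k l) a ha
  | zero_left | zero_right => simp
  | add_left R R' C _ _ _ hR hR' => simpa [ContinuousLinearMap.add_comp] using U.add_mem hR hR'
  | add_right R C C' _ _ _ hC hC' => simpa [ContinuousLinearMap.comp_add] using U.add_mem hC hC'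
  | smul_left c R C _ _ hR => simpa using U.smul_mem c hR
  | smul_right c R C _ _ hC => simpa [map_smulₛₗ] using U.smul_mem (star c) hC

end MatrixCompression

section ApproximateUnit

universe u v

variable {H K : Type*}
  [NormedAddCommGroup H] [InnerProductSpace ℂ H]
  [NormedAddCommGroup K] [InnerProductSpace ℂ K]

theorem tendsto_apply_of_forall_mem_total {α E F : Type*} {l : Filter α}
    [NormedAddCommGroup E] [NormedSpace ℂ E] [NormedAddCommGroup F] [NormedSpace ℂ F]
    {X : α → E →L[ℂ] F} {T : E →L[ℂ] F} {C : NNReal} (hX : ∀ a, ‖X a‖₊ ≤ C) {s : Set E}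
    (hs : (Submodule.span ℂ s).topologicalClosure = ⊤)
    (h : ∀ x ∈ s, Tendsto (fun a => X a x) l (𝓝 (T x))) (x : E) :
    Tendsto (fun a => X a x) l (𝓝 (T x)) := by
  have hclosed : IsClosed {x | Tendsto (fun a => X a x) l (𝓝 (T x))} :=
    (LipschitzWith.uniformEquicontinuous (fun a => X a) C fun a =>
      (X a).lipschitz.weaken (hX a)).equicontinuous.isClosed_setOfPred_tendsto T.continuous
  have hspan : (Submodule.span ℂ s : Set E) ⊆ {x | Tendsto (fun a => X a x) l (𝓝 (T x))} := by
    intro x hx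
    induction hx using Submodule.span_induction with
    | mem x hx => exact h x hx
    | zero => simpa using tendsto_const_nhds
    | add x y _ _ hx hy => simpa using hx.add hy
    | smul c x _ hx => simpa using hx.const_smul c
  have hx : x ∈ (Submodule.span ℂ s).topologicalClosure := hs ▸ Submodule.mem_top
  exact closure_minimal hspan hclosed hx

theorem nonempty_prod_equiv_of_infinite (ι : Type u) (J : Type v) [Infinite ι] [Finite J]
    [Nonempty J] : Nonempty (ι × J ≃ ι) := by
  have hJι : Cardinal.lift.{u} (Cardinal.mk J) ≤ Cardinal.lift.{max u v} (Cardinal.mk ι) :=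
    (Cardinal.lift_lt_aleph0.2 Cardinal.mk_lt_aleph0).le.trans
      (Cardinal.aleph0_le_lift.2 (Cardinal.aleph0_le_mk ι))
  refine Cardinal.lift_mk_eq'.1 ?_
  simp only [Cardinal.mk_prod, Cardinal.lift_mul, Cardinal.lift_lift]
  simpa using Cardinal.mul_eq_left (Cardinal.aleph0_le_lift.2 (Cardinal.aleph0_le_mk ι)) hJι
    (by simp)

/-- Only the zero vector is annihilated by all operators in `M`. -/
def HasTrivialKernel (M : Submodule ℂ (H →L[ℂ] K)) : Prop :=
  ∀ x, (∀ m ∈ M, m x = 0) → x = 0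

variable [CompleteSpace H] [CompleteSpace K] {M : Submodule ℂ (H →L[ℂ] K)}

theorem HasTrivialKernel.topologicalClosure_span_coordIncl_adjoint (hM : HasTrivialKernel M)
    (ι : Type*) :
    (Submodule.span ℂ {z : lp (fun _ : ι => H) 2 |
      ∃ i, ∃ m ∈ M, ∃ y, z = coordIncl H i (adjoint m y)}).topologicalClosure = ⊤ := by
  rw [Submodule.topologicalClosure_eq_top_iff, Submodule.eq_bot_iff]
  intro f hf
  ext i
  refine hM _ fun m hm => ext_inner_left ℂ fun y => ?_
  rw [← ContinuousLinearMap.adjoint_inner_left, inner_zero_right, ← inner_coordIncl_left]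
  exact (Submodule.mem_orthogonal _ f).1 hf _ (Submodule.subset_span ⟨i, m, hm, y, rfl⟩)

variable {ι : Type*} [Infinite ι]

theorem IsTRO.exists_columnOperator (hM : IsTRO M) (hMc : IsClosed (M : Set (H →L[ℂ] K)))
    (F : Finset M) {δ : ℝ} (hδ : 0 < δ) :
    ∃ A : lp (fun _ : ι => H) 2 →L[ℂ] lp (fun _ : ι => K) 2, ‖A‖ ≤ 1 ∧
      HasFiniteRowsIn M A ∧ HasFiniteRowsIn (adjointSpace M) (adjoint A) ∧
      ∀ n ∈ F, ∀ i y, ‖adjoint A (A (coordIncl H i (adjoint (n : H →L[ℂ] K) y))) -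
        coordIncl H i (adjoint (n : H →L[ℂ] K) y)‖ ≤ δ * ‖y‖ := by
  classical
  obtain ⟨m, hmM, hm, happrox⟩ := hM.exists_column hMc
    (n := fun j : ↥(insert 0 F) => (j : H →L[ℂ] K)) (fun j => j.1.2) hδ
  have : Nonempty ↥(insert 0 F) := ⟨⟨0, Finset.mem_insert_self 0 F⟩⟩
  obtain ⟨e⟩ := nonempty_prod_equiv_of_infinite ι ↥(insert 0 F)
  refine ⟨columnOperator e m hm, norm_columnOperator_le e hm,
    hasFiniteRowsIn_columnOperator e hm hmM, hasFiniteRowsIn_adjoint_columnOperator e hm hmM,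
    fun n hn i y => ?_⟩
  rw [adjoint_columnOperator_columnOperator_coordIncl, ← map_sub, norm_coordIncl_apply]
  exact ContinuousLinearMap.le_of_opNorm_le _ (happrox ⟨n, Finset.mem_insert_of_mem hn⟩) y

theorem IsTRO.exists_tendsto_columnOperator (hM : IsTRO M) (hMc : IsClosed (M : Set (H →L[ℂ] K)))
    (hM₀ : HasTrivialKernel M) :
    ∃ A : Finset M × ℕ → lp (fun _ : ι => H) 2 →L[ℂ] lp (fun _ : ι => K) 2,
      (∀ a, ‖A a‖ ≤ 1) ∧ (∀ a, HasFiniteRowsIn M (A a)) ∧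
      (∀ a, HasFiniteRowsIn (adjointSpace M) (adjoint (A a))) ∧
      ∀ x, Tendsto (fun a => adjoint (A a) (A a x)) atTop (𝓝 x) := by
  classical
  choose A hA hrows hcols happrox using fun a : Finset M × ℕ =>
    hM.exists_columnOperator (ι := ι) hMc a.1 (Nat.one_div_pos_of_nat (n := a.2) (α := ℝ))
  have hAA : ∀ a, ‖adjoint (A a) ∘L A a‖₊ ≤ 1 := fun a => by
    rw [← NNReal.coe_le_coe, coe_nnnorm, ContinuousLinearMap.norm_adjoint_comp_self]
    exact mul_le_one₀ (hA a) (norm_nonneg _) (hA a)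
  refine ⟨A, hA, hrows, hcols, tendsto_apply_of_forall_mem_total (T := .id ℂ _) hAA
    (hM₀.topologicalClosure_span_coordIncl_adjoint ι) ?_⟩
  rintro _ ⟨i, m, hm, y, rfl⟩
  have hlim : Tendsto (fun a : Finset M × ℕ => 1 / ((a.2 : ℝ) + 1) * ‖y‖) atTop (𝓝 0) := by
    rw [← prod_atTop_atTop_eq]
    simpa using (tendsto_one_div_add_atTop_nhds_zero_nat.comp tendsto_snd).mul_const ‖y‖
  refine tendsto_iff_norm_sub_tendsto_zero.2 (squeeze_zero' (.of_forall fun a => norm_nonneg _) ?_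
    hlim)
  filter_upwards [eventually_ge_atTop (({⟨m, hm⟩} : Finset M), 0)] with a ha
  exact happrox a ⟨m, hm⟩ (ha.1 (Finset.mem_singleton_self _)) i y

end ApproximateUnit

section Comparison

variable {E₁ E₂ F₁ F₂ : Type*}
  [NormedAddCommGroup E₁] [InnerProductSpace ℂ E₁]
  [NormedAddCommGroup E₂] [InnerProductSpace ℂ E₂]
  [NormedAddCommGroup F₁] [InnerProductSpace ℂ F₁]
  [NormedAddCommGroup F₂] [InnerProductSpace ℂ F₂]
  {U : Submodule ℂ (F₁ →L[ℂ] F₂)} {V : Submodule ℂ (E₁ →L[ℂ] E₂)}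

theorem norm_comp_comp_le {A : E₁ →L[ℂ] F₁} {B : F₂ →L[ℂ] E₂} (hA : ‖A‖ ≤ 1) (hB : ‖B‖ ≤ 1)
    (S : F₁ →L[ℂ] F₂) : ‖B ∘L S ∘L A‖ ≤ ‖S‖ :=
  calc ‖B ∘L S ∘L A‖ ≤ ‖B‖ * ‖S ∘L A‖ := ContinuousLinearMap.opNorm_comp_le _ _
    _ ≤ ‖B‖ * (‖S‖ * ‖A‖) := by gcongr; exact ContinuousLinearMap.opNorm_comp_le _ _
    _ ≤ 1 * (‖S‖ * 1) := by gcongr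
    _ = ‖S‖ := by ring

theorem opDist_comp_comp_le {A : E₁ →L[ℂ] F₁} {B : F₂ →L[ℂ] E₂} (hA : ‖A‖ ≤ 1) (hB : ‖B‖ ≤ 1)
    (hUV : ∀ X ∈ U, B ∘L X ∘L A ∈ V) (S : F₁ →L[ℂ] F₂) :
    opDist (B ∘L S ∘L A) V ≤ opDist S U := by
  refine le_iInf₂ fun X hX => (iInf₂_le _ (hUV X hX)).trans ?_
  rw [← ContinuousLinearMap.comp_sub, ← ContinuousLinearMap.sub_comp, enorm_le_iff_norm_le]
  exact norm_comp_comp_le hA hB (S - X)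

theorem enorm_inner_le_reflexiveSeminorm (T : E₁ →L[ℂ] E₂) {x : E₁} {y : E₂} (hx : ‖x‖ ≤ 1)
    (hy : ‖y‖ ≤ 1) (hxy : ∀ X ∈ V, ⟪y, X x⟫_ℂ = 0) :
    ‖⟪y, T x⟫_ℂ‖ₑ ≤ reflexiveSeminorm V T := by
  rcases eq_or_ne x 0 with rfl | hx0
  · simp
  rcases eq_or_ne y 0 with rfl | hy0
  · simp
  let x' : E₁ := (‖x‖⁻¹ : ℂ) • x
  let y' : E₂ := (‖y‖⁻¹ : ℂ) • y
  have hin : ∀ X : E₁ →L[ℂ] E₂, ⟪y', X x'⟫_ℂ = (‖x‖⁻¹ * ‖y‖⁻¹ : ℂ) * ⟪y, X x⟫_ℂ := fun X => by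
    simp only [x', y', map_smul, inner_smul_left, inner_smul_right, map_inv₀,
      Complex.conj_ofReal, Complex.ofReal_inv]
    ring
  have hle : ‖⟪y, T x⟫_ℂ‖ ≤ ‖⟪y', T x'⟫_ℂ‖ := by
    rw [hin, norm_mul]
    refine le_mul_of_one_le_left (norm_nonneg _) ?_
    simpa using one_le_mul_of_one_le_of_one_le
      ((one_le_inv₀ (norm_pos_iff.2 hx0)).2 hx) ((one_le_inv₀ (norm_pos_iff.2 hy0)).2 hy)
  refine (enorm_le_iff_norm_le.2 hle).trans (le_iSup₂_of_le x' y' (le_iSup₂_of_le ?_ ?_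
    (le_iSup_of_le (fun X hX => ?_) le_rfl)))
  · exact norm_smul_inv_norm hx0
  · exact norm_smul_inv_norm hy0
  · rw [hin, hxy X hX, mul_zero]

theorem reflexiveSeminorm_le_enorm (V : Submodule ℂ (E₁ →L[ℂ] E₂)) (T : E₁ →L[ℂ] E₂) :
    reflexiveSeminorm V T ≤ ‖T‖ₑ := by
  refine iSup₂_le fun x y => iSup₂_le fun hx hy => iSup_le fun _ => enorm_le_iff_norm_le.2 ?_
  calc ‖⟪y, T x⟫_ℂ‖ ≤ ‖y‖ * ‖T x‖ := norm_inner_le_norm _ _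
    _ ≤ ‖y‖ * (‖T‖ * ‖x‖) := by gcongr; exact T.le_opNorm x
    _ = ‖T‖ := by rw [hx, hy]; ring

theorem opDist_le_mul_reflexiveSeminorm (hV : hyperreflexivityConstant V ≠ ⊤) (T : E₁ →L[ℂ] E₂) :
    opDist T V ≤ hyperreflexivityConstant V * reflexiveSeminorm V T := by
  by_cases hT : T ∈ V
  · have hzero : opDist T V ≤ 0 := (iInf₂_le T hT).trans_eq <| by
      rw [sub_self, ← ofReal_norm, norm_zero, ENNReal.ofReal_zero]
    exact hzero.trans zero_le
  · have hquot : opDist T V / reflexiveSeminorm V T ≤ hyperreflexivityConstant V :=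
      le_iSup₂_of_le T hT le_rfl
    have hfin : reflexiveSeminorm V T ≠ ⊤ :=
      ((reflexiveSeminorm_le_enorm V T).trans_lt enorm_lt_top).ne
    exact (ENNReal.div_le_iff_le_mul (Or.inr hV) (Or.inl hfin)).1 hquot

variable [CompleteSpace E₁] [CompleteSpace E₂] [CompleteSpace F₁] [CompleteSpace F₂]

theorem reflexiveSeminorm_comp_comp_adjoint_le {A : E₁ →L[ℂ] F₁} {B : E₂ →L[ℂ] F₂}
    (hA : ‖A‖ ≤ 1) (hB : ‖B‖ ≤ 1) (hVU : ∀ X ∈ V, B ∘L X ∘L adjoint A ∈ U) (T : E₁ →L[ℂ] E₂) :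
    reflexiveSeminorm U (B ∘L T ∘L adjoint A) ≤ reflexiveSeminorm V T := by
  refine iSup₂_le fun x y => iSup₂_le fun hx hy => iSup_le fun hxy => ?_
  have hin : ∀ X : E₁ →L[ℂ] E₂, ⟪y, (B ∘L X ∘L adjoint A) x⟫_ℂ =
      ⟪adjoint B y, X (adjoint A x)⟫_ℂ := fun X =>
    (ContinuousLinearMap.adjoint_inner_left B _ _).symm
  rw [hin]
  refine enorm_inner_le_reflexiveSeminorm T ?_ ?_ fun X hX => ?_
  · simpa [hx] using (adjoint A).le_of_opNorm_le ((LinearIsometryEquiv.norm_map _ _).trans_le hA) x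
  · simpa [hy] using (adjoint B).le_of_opNorm_le ((LinearIsometryEquiv.norm_map _ _).trans_le hB) y
  · rw [← hin]
    exact hxy _ (hVU X hX)

theorem hyperreflexivityConstant_le_of_approx_compression (hV : IsWeakStarClosed V) {α : Type*}
    {l : Filter α} [NeBot l] {A : α → E₁ →L[ℂ] F₁} {B : α → E₂ →L[ℂ] F₂}
    (hA : ∀ a, ‖A a‖ ≤ 1) (hB : ∀ a, ‖B a‖ ≤ 1)
    (hAlim : ∀ x, Tendsto (fun a => adjoint (A a) (A a x)) l (𝓝 x))
    (hBlim : ∀ y, Tendsto (fun a => adjoint (B a) (B a y)) l (𝓝 y))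
    (hVU : ∀ a, ∀ X ∈ V, B a ∘L X ∘L adjoint (A a) ∈ U)
    (hUV : ∀ a, ∀ X ∈ U, adjoint (B a) ∘L X ∘L A a ∈ V) :
    hyperreflexivityConstant V ≤ hyperreflexivityConstant U := by
  rcases eq_or_ne (hyperreflexivityConstant U) ⊤ with hU | hU
  · exact hU ▸ le_top
  have hA' : ∀ a, ‖adjoint (A a)‖ ≤ 1 := fun a => (LinearIsometryEquiv.norm_map _ _).trans_le (hA a)
  have hB' : ∀ a, ‖adjoint (B a)‖ ≤ 1 := fun a => (LinearIsometryEquiv.norm_map _ _).trans_le (hB a)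
  refine iSup₂_le fun T _ => ENNReal.div_le_of_le_mul ?_
  let S : α → F₁ →L[ℂ] F₂ := fun a => B a ∘L T ∘L adjoint (A a)
  refine hV.opDist_le_of_tendsto_inner (X := fun a => adjoint (B a) ∘L S a ∘L A a) (l := l)
    (fun a => (norm_comp_comp_le (hA a) (hB' a) _).trans (norm_comp_comp_le (hA' a) (hB a) T))
    (fun x y => ?_) fun a => ?_
  · refine ((hBlim y).inner ((T.continuous.tendsto x).comp (hAlim x))).congr fun a => ?_
    simp [S, ContinuousLinearMap.adjoint_inner_left, ContinuousLinearMap.adjoint_inner_right]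
  · calc opDist (adjoint (B a) ∘L S a ∘L A a) V
        ≤ opDist (S a) U := opDist_comp_comp_le (hA a) (hB' a) (hUV a) (S a)
      _ ≤ hyperreflexivityConstant U * reflexiveSeminorm U (S a) :=
          opDist_le_mul_reflexiveSeminorm hU (S a)
      _ ≤ hyperreflexivityConstant U * reflexiveSeminorm V T := by
          gcongr
          exact reflexiveSeminorm_comp_comp_adjoint_le (hA a) (hB a) (hVU a) T

end Comparison

section TROEquivalence

theorem eq_zero_of_erdosMap_top {H K : Type*}
    [NormedAddCommGroup H] [InnerProductSpace ℂ H]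
    [NormedAddCommGroup K] [InnerProductSpace ℂ K] [CompleteSpace K]
    {S : Set (H →L[ℂ] K)} (hS : erdosMap S ⊤ = ⊤) {z : K}
    (hz : ∀ T ∈ S, ∀ x, ⟪z, T x⟫_ℂ = 0) : z = 0 := by
  have hortho : z ∈ (Submodule.span ℂ {w : K | ∃ T ∈ S, ∃ y ∈ (⊤ : Submodule ℂ H), w = T y})ᗮ := by
    rw [Submodule.mem_orthogonal']
    intro u hu
    induction hu using Submodule.span_induction with
    | mem u hu =>
      obtain ⟨T, hT, x, -, rfl⟩ := hu
      exact hz T hT x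
    | zero => exact inner_zero_right z
    | add u v _ _ hu hv => rw [inner_add_right, hu, hv, add_zero]
    | smul c u _ hu => rw [inner_smul_right, hu, mul_zero]
  rwa [Submodule.topologicalClosure_eq_top_iff.1 hS, Submodule.mem_bot] at hortho

section Adjoints

variable {H K : Type*}
  [NormedAddCommGroup H] [InnerProductSpace ℂ H] [CompleteSpace H]
  [NormedAddCommGroup K] [InnerProductSpace ℂ K] [CompleteSpace K]
  {M : Submodule ℂ (H →L[ℂ] K)}

theorem exists_mem_adjointSpace {p : (K →L[ℂ] H) → Prop} :
    (∃ B ∈ adjointSpace M, p B) ↔ ∃ B ∈ M, p (adjoint B) := by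
  refine ⟨fun ⟨B, hB, h⟩ => ⟨adjoint B, hB, ?_⟩, fun ⟨B, hB, h⟩ => ⟨adjoint B, ?_, h⟩⟩
  · rwa [ContinuousLinearMap.adjoint_adjoint]
  · rwa [mem_adjointSpace, ContinuousLinearMap.adjoint_adjoint]

theorem IsTRO.adjointSpace (hM : IsTRO M) : IsTRO (adjointSpace M) := by
  intro A hA B hB C hC
  rw [mem_adjointSpace, ContinuousLinearMap.adjoint_comp, ContinuousLinearMap.adjoint_comp]
  exact hM _ hC _ hB _ hA

end Adjoints

section TrivialKernels

variable {H₁ H₂ K₁ K₂ : Type*}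
  [NormedAddCommGroup H₁] [InnerProductSpace ℂ H₁] [CompleteSpace H₁]
  [NormedAddCommGroup H₂] [InnerProductSpace ℂ H₂] [CompleteSpace H₂]
  [NormedAddCommGroup K₁] [InnerProductSpace ℂ K₁]
  [NormedAddCommGroup K₂] [InnerProductSpace ℂ K₂] [CompleteSpace K₂]
  {U : Submodule ℂ (K₁ →L[ℂ] K₂)} {V : Submodule ℂ (H₁ →L[ℂ] H₂)}
  {M₁ : Submodule ℂ (H₁ →L[ℂ] K₁)} {M₂ : Submodule ℂ (H₂ →L[ℂ] K₂)}
  (hVess : IsEssential V)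
  (hV : (V : Set (H₁ →L[ℂ] H₂)) ⊆
    weakStarSpan {X | ∃ B ∈ M₂, ∃ T ∈ U, ∃ A ∈ M₁, X = adjoint B ∘L T ∘L A})

include hVess hV

theorem IsEssential.hasTrivialKernel_right : HasTrivialKernel M₁ := fun x hx => by
  refine eq_zero_of_erdosMap_top hVess.2 ?_
  rintro _ ⟨T, hT, rfl⟩ y
  rw [ContinuousLinearMap.adjoint_inner_right, ← inner_conj_symm,
    inner_eq_zero_of_mem_weakStarSpan (y := y) ?_ (hV hT), map_zero]
  rintro _ ⟨B, -, X, -, A, hA, rfl⟩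
  simp [hx A hA]

theorem IsEssential.hasTrivialKernel_left : HasTrivialKernel M₂ := fun y hy => by
  refine eq_zero_of_erdosMap_top hVess.1 fun T hT x =>
    inner_eq_zero_of_mem_weakStarSpan ?_ (hV hT)
  rintro _ ⟨B, hB, X, -, A, -, rfl⟩
  simp [ContinuousLinearMap.adjoint_inner_right, hy B hB]

end TrivialKernels

variable {H₁ H₂ K₁ K₂ : Type*}
  [NormedAddCommGroup H₁] [InnerProductSpace ℂ H₁] [CompleteSpace H₁]
  [NormedAddCommGroup H₂] [InnerProductSpace ℂ H₂] [CompleteSpace H₂]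
  [NormedAddCommGroup K₁] [InnerProductSpace ℂ K₁] [CompleteSpace K₁]
  [NormedAddCommGroup K₂] [InnerProductSpace ℂ K₂] [CompleteSpace K₂]
  {U : Submodule ℂ (K₁ →L[ℂ] K₂)} {V : Submodule ℂ (H₁ →L[ℂ] H₂)}

theorem WeakTROEquivalent.symm (h : WeakTROEquivalent U V) : WeakTROEquivalent V U := by
  obtain ⟨M₁, M₂, hM₁, hM₂, hU, hV⟩ := h
  refine ⟨adjointSpace M₁, adjointSpace M₂, hM₁.adjointSpace, hM₂.adjointSpace, ?_, ?_⟩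
  · simpa only [exists_mem_adjointSpace, ContinuousLinearMap.adjoint_adjoint] using hV
  · simpa only [exists_mem_adjointSpace, ContinuousLinearMap.adjoint_adjoint] using hU

theorem WeakTROEquivalent.isWeakStarClosed (h : WeakTROEquivalent U V) : IsWeakStarClosed U := by
  obtain ⟨M₁, M₂, -, -, hU, -⟩ := h
  exact isWeakStarClosed_of_eq_weakStarSpan hU

theorem WeakTROEquivalent.exists_isClosed_isTRO (h : WeakTROEquivalent U V)
    (hVess : IsEssential V) :
    ∃ (M₁ : Submodule ℂ (H₁ →L[ℂ] K₁)) (M₂ : Submodule ℂ (H₂ →L[ℂ] K₂)),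
      (IsTRO M₁ ∧ IsClosed (M₁ : Set (H₁ →L[ℂ] K₁)) ∧ HasTrivialKernel M₁) ∧
      (IsTRO M₂ ∧ IsClosed (M₂ : Set (H₂ →L[ℂ] K₂)) ∧ HasTrivialKernel M₂) ∧
      (∀ b ∈ M₂, ∀ T ∈ V, ∀ a ∈ M₁, b ∘L T ∘L adjoint a ∈ U) ∧
      ∀ b ∈ M₂, ∀ X ∈ U, ∀ a ∈ M₁, adjoint b ∘L X ∘L a ∈ V := by
  have hUc : IsClosed (U : Set (K₁ →L[ℂ] K₂)) := h.isWeakStarClosed.isClosed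
  have hVc : IsClosed (V : Set (H₁ →L[ℂ] H₂)) := h.symm.isWeakStarClosed.isClosed
  obtain ⟨M₁, M₂, hM₁, hM₂, hU, hV⟩ := h
  refine ⟨M₁.topologicalClosure, M₂.topologicalClosure,
    ⟨hM₁.topologicalClosure, M₁.isClosed_topologicalClosure, fun x hx =>
      hVess.hasTrivialKernel_right hV.subset x fun m hm => hx m (subset_closure hm)⟩,
    ⟨hM₂.topologicalClosure, M₂.isClosed_topologicalClosure, fun y hy =>
      hVess.hasTrivialKernel_left hV.subset y fun m hm => hy m (subset_closure hm)⟩,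
    fun b hb T hT a ha => ?_, fun b hb X hX a ha => ?_⟩
  · rw [← SetLike.mem_coe, ← hUc.closure_eq]
    refine map_mem_closure₂ (f := fun (b : H₂ →L[ℂ] K₂) (a : H₁ →L[ℂ] K₁) => b ∘L T ∘L adjoint a)
      (by fun_prop) hb ha fun b hb a ha => ?_
    exact hU.superset (subset_weakStarSpan _ ⟨b, hb, T, hT, a, ha, rfl⟩)
  · rw [← SetLike.mem_coe, ← hVc.closure_eq]
    refine map_mem_closure₂ (f := fun (b : H₂ →L[ℂ] K₂) (a : H₁ →L[ℂ] K₁) => adjoint b ∘L X ∘L a)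
      (by fun_prop) hb ha fun b hb a ha => ?_
    exact hV.superset (subset_weakStarSpan _ ⟨b, hb, X, hX, a, ha, rfl⟩)

end TROEquivalence

end OperatorSpaces

theorem theorem3p6_general
    {H₁ H₂ K₁ K₂ : Type*}
    [NormedAddCommGroup H₁] [InnerProductSpace ℂ H₁] [CompleteSpace H₁]
    [NormedAddCommGroup H₂] [InnerProductSpace ℂ H₂] [CompleteSpace H₂]
    [NormedAddCommGroup K₁] [InnerProductSpace ℂ K₁] [CompleteSpace K₁]
    [NormedAddCommGroup K₂] [InnerProductSpace ℂ K₂] [CompleteSpace K₂]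
    (U : Submodule ℂ (K₁ →L[ℂ] K₂)) (V : Submodule ℂ (H₁ →L[ℂ] H₂))
    (hVess : OperatorSpaces.IsEssential V) (hUV : OperatorSpaces.WeakTROEquivalent U V)
    (ι : Type*) [Infinite ι] :
    OperatorSpaces.hyperreflexivityConstant (OperatorSpaces.matrixSpace ι V) ≤
      OperatorSpaces.hyperreflexivityConstant (OperatorSpaces.matrixSpace ι U) := by
  classical
  obtain ⟨M₁, M₂, ⟨hM₁, hM₁c, hM₁₀⟩, ⟨hM₂, hM₂c, hM₂₀⟩, hVU, hUV'⟩ :=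
    hUV.exists_isClosed_isTRO hVess
  obtain ⟨A, hA, hArows, hAcols, hAlim⟩ := hM₁.exists_tendsto_columnOperator (ι := ι) hM₁c hM₁₀
  obtain ⟨B, hB, hBrows, hBcols, hBlim⟩ := hM₂.exists_tendsto_columnOperator (ι := ι) hM₂c hM₂₀
  refine OperatorSpaces.hyperreflexivityConstant_le_of_approx_compression
    (hUV.symm.isWeakStarClosed.matrixSpace ι) (l := Filter.atTop ×ˢ Filter.atTop)
    (A := fun p => A p.1) (B := fun p => B p.2) (fun p => hA p.1) (fun p => hB p.2)
    (fun x => (hAlim x).comp Filter.tendsto_fst) (fun y => (hBlim y).comp Filter.tendsto_snd)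
    (fun p T hT => (hBrows p.2).comp_comp_adjoint_mem_matrixSpace (hArows p.1) hVU hT)
    fun p X hX => ?_
  rw [← ContinuousLinearMap.adjoint_adjoint (A p.1)]
  exact (hBcols p.2).comp_comp_adjoint_mem_matrixSpace (hAcols p.1)
    (fun b hb X hX a ha => by
      rw [← ContinuousLinearMap.adjoint_adjoint b]
      exact hUV' _ hb X hX _ ha) hX

theorem theorem3p6
    {H₁ H₂ K₁ K₂ : Type*}
    [NormedAddCommGroup H₁] [InnerProductSpace ℂ H₁] [CompleteSpace H₁]
    [NormedAddCommGroup H₂] [InnerProductSpace ℂ H₂] [CompleteSpace H₂]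
    [NormedAddCommGroup K₁] [InnerProductSpace ℂ K₁] [CompleteSpace K₁]
    [NormedAddCommGroup K₂] [InnerProductSpace ℂ K₂] [CompleteSpace K₂]
    (U : Submodule ℂ (K₁ →L[ℂ] K₂)) (V : Submodule ℂ (H₁ →L[ℂ] H₂))
    (hU : OperatorSpaces.IsWeakStarClosed U) (hV : OperatorSpaces.IsWeakStarClosed V)
    (hUess : OperatorSpaces.IsEssential U) (hVess : OperatorSpaces.IsEssential V)
    (hUV : OperatorSpaces.WeakTROEquivalent U V) :
    (∀ (ι κ₁ κ₂ : Type*) (_ : Infinite ι)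
        (_ : HilbertBasis κ₁ ℂ H₁) (_ : HilbertBasis κ₂ ℂ H₂)
        (_ : Nonempty (κ₁ ↪ ι)) (_ : Nonempty (κ₂ ↪ ι)),
      OperatorSpaces.hyperreflexivityConstant (OperatorSpaces.matrixSpace ι V) ≤
        OperatorSpaces.hyperreflexivityConstant (OperatorSpaces.matrixSpace ι U)) ∧
    (TopologicalSpace.SeparableSpace H₁ → TopologicalSpace.SeparableSpace H₂ →
      TopologicalSpace.SeparableSpace K₁ → TopologicalSpace.SeparableSpace K₂ →
      OperatorSpaces.hyperreflexivityConstant (OperatorSpaces.matrixSpace ℕ V) =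
        OperatorSpaces.hyperreflexivityConstant (OperatorSpaces.matrixSpace ℕ U)) := by
  exact ⟨fun ι _ _ _ _ _ _ _ => theorem3p6_general U V hVess hUV ι, fun _ _ _ _ =>
    le_antisymm (theorem3p6_general U V hVess hUV ℕ) (theorem3p6_general V U hUess hUV.symm ℕ)⟩
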